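/- Let $D\ge 2$ and $N\ge 0$ be integers and $s>0$. Let $f_t,f_s\sim\mathcal N(0,I_D)$ and $w_1,\dots,w_N\sim\mathcal N(0,s^2I_D)$ be mutually independent random vectors in $\mathbb R^D$ (teacher feature, student feature, and the weight vectors of $N$ hash functions with zero bias). For $1\le j\le N$ put $$h_j=\begin{cases}1,& w_j^{\mathsf T}f_t>0,\\ 0,&\text{otherwise,}\end{cases}\qquad p_j=\frac{1}{1+\exp(-w_j^{\mathsf T}f_s)},\qquad l_j=-h_j\log p_j-(1-h_j)\log(1-p_j),$$ and let $\angle(f_t,f_s)\in[0,\pi]$ be the angle between $f_t$ and $f_s$. Then the event $\bigwedge_{j=1}^N(l_j<\log 2)$ has positive probability, the integral $\int_0^\pi(1-\theta/\pi)^N\sin^{D-2}(\theta)\,\mathrm d\theta$ is positive, and for every $0<\epsilon<\pi$ $$\mathbb P\Bigl(\angle(f_t,f_s)<\epsilon\ \Big|\ \bigwedge_{j=1}^N (l_j<\log 2)\Bigr)=\frac{\int_0^\epsilon\left(1-\frac{\theta}{\pi}\right)^N\sin^{D-2}(\theta)\,\mathrm d\theta}{\int_0^\pi\left(1-\frac{\theta}{\pi}\right)^N\sin^{D-2}(\theta)\,\mathrm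 d\theta}.$$ -/

import Mathlib

open MeasureTheory ProbabilityTheory
open scoped ENNReal NNReal

/-- The threshold function of the hashing module: `1` if `x > 0` and `0` otherwise. -/
noncomputable def hashSign (x : ℝ) : ℝ := if 0 < x then 1 else 0

/-- The hash code `h = sign(wᵀ f_t + b)` of the teacher feature `f_t`. -/
noncomputable def hashCode {D : ℕ} (w : EuclideanSpace ℝ (Fin D)) (b : ℝ)
    (ft : EuclideanSpace ℝ (Fin D)) : ℝ :=
  hashSign (inner ℝ w ft + b)

/-- The prediction `p = σ(wᵀ f_s + b)` computed from the student feature `f_s`, where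
`σ x = 1 / (1 + exp (-x))` is the sigmoid function. -/
noncomputable def hashPred {D : ℕ} (w : EuclideanSpace ℝ (Fin D)) (b : ℝ)
    (fs : EuclideanSpace ℝ (Fin D)) : ℝ :=
  Real.sigmoid (inner ℝ w fs + b)

/-- The binary cross entropy `l = -h log p - (1 - h) log (1 - p)` of one hash function with
weight vector `w` and bias `b`. -/
noncomputable def hashLoss {D : ℕ} (w : EuclideanSpace ℝ (Fin D)) (b : ℝ)
    (ft fs : EuclideanSpace ℝ (Fin D)) : ℝ :=
  -hashCode w b ft * Real.log (hashPred w b fs)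
    - (1 - hashCode w b ft) * Real.log (1 - hashPred w b fs)

/-!
The loss of a hash function is below `log 2` exactly if its prediction lies on the correct side of
`1 / 2`, that is, if the signs of `⟪w, f_t⟫` and `⟪w, f_s⟫` agree
(`hashLoss_zero_lt_log_two_iff`). The conditional probability then follows from two computations.

* For fixed nonzero `x`, `y` at angle `θ`, a Gaussian `w` satisfies this with probability
  `1 - θ / π` (`stdGaussian_signsAgree`; the scale `s` is irrelevant): the pair of inner products
  depends only on the projection of `w` to a plane containing `x` and `y`, which is a planar standard
  Gaussian, and the event is, up to a null set, a pair of opposite wedges of opening `π - θ` each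
  (`gaussianReal_prod_wedge`).
* For fixed `x ≠ 0` and Gaussian `y` of dimension `n + 2`, the angle of `x` and `y` has a density
  proportional to `sin ^ n` (`exists_lintegral_angle_stdGaussian`). In an orthonormal basis starting
  with the direction of `x`, let `u` be the first coordinate of `y` and `v` the norm of the others.
  The pair `(u, v)` has a density proportional to `v ^ n * exp (-(u ^ 2 + v ^ 2) / 2)` on the upper
  half plane; its polar angle is the angle sought, and its polar radius is the norm of `y`. Hence the
  same change of variables also gives, by induction on the dimension, the density of the norm that
  is needed for `v` (`exists_lintegral_gaussian_radial`).

By Fubini, the probability of the event together with `angle ∈ B` is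
`K * ∫ φ in B ∩ (0, π), (1 - φ / π) ^ N * sin φ ^ n` for one constant `K`
(`exists_measure_agreeAngleSet`), and `K ≠ 0, ∞` cancels in the quotient.
-/

/-! ### Planar Gaussian integrals in polar coordinates -/

/-- Polar coordinates on the open upper half plane. -/
lemma lintegral_upperHalfPlane_polar {H : ℝ × ℝ → ℝ≥0∞} (hH : Measurable H) :
    ∫⁻ u, ∫⁻ v in Set.Ioi (0 : ℝ), H (u, v) =
      ∫⁻ r in Set.Ioi (0 : ℝ), ∫⁻ φ in Set.Ioo 0 Real.pi,
        ENNReal.ofReal r * H (r * Real.cos φ, r * Real.sin φ) := by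
  have hS : MeasurableSet {p : ℝ × ℝ | 0 < p.2} := measurableSet_lt measurable_const measurable_snd
  have hmeas : Measurable ({p : ℝ × ℝ | 0 < p.2}.indicator H) := hH.indicator hS
  have h1 : ∫⁻ u, ∫⁻ v in Set.Ioi (0 : ℝ), H (u, v) =
      ∫⁻ p : ℝ × ℝ, {p : ℝ × ℝ | 0 < p.2}.indicator H p := by
    rw [Measure.volume_eq_prod, lintegral_prod _ hmeas.aemeasurable]
    refine lintegral_congr fun u ↦ ?_
    rw [← lintegral_indicator measurableSet_Ioi]
    rfl
  rw [h1, ← lintegral_comp_polarCoord_symm, polarCoord_target, Measure.volume_eq_prod,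
    ← Measure.prod_restrict, lintegral_prod _ (by
      have : Measurable fun p : ℝ × ℝ ↦ polarCoord.symm p := continuous_polarCoord_symm.measurable
      simp only [smul_eq_mul]
      exact (by fun_prop : Measurable fun p : ℝ × ℝ ↦ _).aemeasurable)]
  refine setLIntegral_congr_fun measurableSet_Ioi fun r hr ↦ ?_
  have hr : 0 < r := hr
  rw [← lintegral_indicator measurableSet_Ioo, ← lintegral_indicator measurableSet_Ioo]
  refine lintegral_congr fun φ ↦ ?_
  simp only [Set.indicator, polarCoord_symm_apply, Set.mem_Ioo, Set.mem_ofPred_eq, smul_eq_mul]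
  by_cases hφ : 0 < φ ∧ φ < Real.pi
  · have := Real.sin_pos_of_mem_Ioo hφ
    rw [if_pos ⟨by linarith, hφ.2⟩, if_pos (by positivity), if_pos hφ]
  · rw [if_neg hφ]
    split_ifs with h2 h3
    · have h0 : φ ≤ 0 := by by_contra h; exact hφ ⟨by linarith, h2.2⟩
      have := Real.sin_nonpos_of_nonpos_of_neg_pi_le h0 h2.1.le
      nlinarith
    · simp
    · rfl

lemma lintegral_gaussianReal_zero_one (f : ℝ → ℝ≥0∞) (hf : Measurable f) :
    ∫⁻ u, f u ∂(gaussianReal 0 1) = ENNReal.ofReal (√(2 * Real.pi))⁻¹ *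
      ∫⁻ u, ENNReal.ofReal (Real.exp (-u ^ 2 / 2)) * f u := by
  rw [gaussianReal_of_var_ne_zero _ one_ne_zero,
    lintegral_withDensity_eq_lintegral_mul _ (measurable_gaussianPDF 0 1) hf,
    ← lintegral_const_mul _ (by fun_prop)]
  refine lintegral_congr fun u ↦ ?_
  simp only [Pi.mul_apply, gaussianPDF, gaussianPDFReal]
  rw [ENNReal.ofReal_mul (by positivity), mul_assoc]
  simp

/-- An event of the plane depending on the polar angle only has Gaussian probability the
proportion of the angles it contains. -/
lemma gaussianReal_prod_of_angular {A : Set (ℝ × ℝ)} {T : Set ℝ} (hA : MeasurableSet A)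
    (hT : MeasurableSet T) (h : ∀ r > 0, ∀ φ ∈ Set.Ioo (-Real.pi) Real.pi,
      (r * Real.cos φ, r * Real.sin φ) ∈ A ↔ φ ∈ T) :
    ((gaussianReal 0 1).prod (gaussianReal 0 1)) A =
      volume (T ∩ Set.Ioo (-Real.pi) Real.pi) / ENNReal.ofReal (2 * Real.pi) := by
  -- the density is radial, so the integral over the radius is a common factor
  obtain ⟨C, hC⟩ : ∃ C : ℝ≥0∞, ∀ (A : Set (ℝ × ℝ)) (T : Set ℝ), MeasurableSet A → MeasurableSet T →
      (∀ r > 0, ∀ φ ∈ Set.Ioo (-Real.pi) Real.pi,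
        (r * Real.cos φ, r * Real.sin φ) ∈ A ↔ φ ∈ T) →
      ((gaussianReal 0 1).prod (gaussianReal 0 1)) A =
        C * volume (T ∩ Set.Ioo (-Real.pi) Real.pi) := by
    refine ⟨ENNReal.ofReal (√(2 * Real.pi))⁻¹ * ENNReal.ofReal (√(2 * Real.pi))⁻¹ *
      ∫⁻ r in Set.Ioi (0 : ℝ), ENNReal.ofReal r * ENNReal.ofReal (Real.exp (-r ^ 2 / 2)),
      fun A T hA hT h ↦ ?_⟩
    have hm : Measurable (A.indicator (1 : ℝ × ℝ → ℝ≥0∞)) := measurable_one.indicator hA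
    have hm2 : ∀ u, Measurable fun v ↦ A.indicator (1 : ℝ × ℝ → ℝ≥0∞) (u, v) :=
      fun u ↦ hm.comp measurable_prodMk_left
    rw [← lintegral_indicator_one hA, lintegral_prod _ hm.aemeasurable]
    simp_rw [fun u ↦ lintegral_gaussianReal_zero_one _ (hm2 u)]
    rw [lintegral_gaussianReal_zero_one _ (by fun_prop)]
    have : ∀ u : ℝ, ENNReal.ofReal (Real.exp (-u ^ 2 / 2)) *
        (ENNReal.ofReal (√(2 * Real.pi))⁻¹ * ∫⁻ v, ENNReal.ofReal (Real.exp (-v ^ 2 / 2)) *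
          A.indicator (1 : ℝ × ℝ → ℝ≥0∞) (u, v)) = ENNReal.ofReal (√(2 * Real.pi))⁻¹ *
        ∫⁻ v, ENNReal.ofReal (Real.exp (-(u ^ 2 + v ^ 2) / 2)) *
          A.indicator (1 : ℝ × ℝ → ℝ≥0∞) (u, v) := by
      intro u
      rw [mul_left_comm, ← lintegral_const_mul _ (by fun_prop)]
      congr 1
      refine lintegral_congr fun v ↦ ?_
      rw [← mul_assoc, ← ENNReal.ofReal_mul (by positivity), ← Real.exp_add]
      congr 4; ring
    simp_rw [this]
    have hm3 : Measurable fun p : ℝ × ℝ ↦ ENNReal.ofReal (Real.exp (-(p.1 ^ 2 + p.2 ^ 2) / 2)) *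
          A.indicator (1 : ℝ × ℝ → ℝ≥0∞) p := by fun_prop
    rw [lintegral_const_mul _ (by fun_prop), ← mul_assoc, mul_assoc (_ * _)]
    congr 1
    have key := lintegral_prod (μ := (volume : Measure ℝ)) (ν := (volume : Measure ℝ)) _
      hm3.aemeasurable
    have hsymm : Measurable fun p : ℝ × ℝ ↦ polarCoord.symm p :=
      continuous_polarCoord_symm.measurable
    have hm4 : Measurable fun p : ℝ × ℝ ↦ ENNReal.ofReal p.1 *
        (ENNReal.ofReal (Real.exp (-((polarCoord.symm p).1 ^ 2 + (polarCoord.symm p).2 ^ 2) / 2)) *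
          A.indicator (1 : ℝ × ℝ → ℝ≥0∞) (polarCoord.symm p)) := by fun_prop
    rw [← key, ← Measure.volume_eq_prod, ← lintegral_comp_polarCoord_symm, polarCoord_target,
      Measure.volume_eq_prod, ← Measure.prod_restrict]
    simp only [smul_eq_mul]
    rw [lintegral_prod _ hm4.aemeasurable, ← lintegral_mul_const _ (by fun_prop)]
    refine setLIntegral_congr_fun measurableSet_Ioi fun r hr ↦ ?_
    rw [← Measure.restrict_apply hT, ← lintegral_indicator_one hT, ← lintegral_const_mul _
      (measurable_one.indicator hT)]
    refine setLIntegral_congr_fun measurableSet_Ioo fun φ hφ ↦ ?_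
    simp only [polarCoord_symm_apply]
    have hr2 : (r * Real.cos φ) ^ 2 + (r * Real.sin φ) ^ 2 = r ^ 2 := by
      rw [mul_pow, mul_pow, ← mul_add, Real.cos_sq_add_sin_sq, mul_one]
    have hAT : A.indicator (1 : ℝ × ℝ → ℝ≥0∞) (r * Real.cos φ, r * Real.sin φ) =
        T.indicator 1 φ := by
      by_cases hT : φ ∈ T
      · rw [Set.indicator_of_mem hT, Set.indicator_of_mem ((h r hr φ hφ).2 hT)]; rfl
      · rw [Set.indicator_of_notMem hT, Set.indicator_of_notMem (mt (h r hr φ hφ).1 hT)]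
    rw [hr2, hAT, mul_assoc]
  -- the constant is found by taking the whole plane
  have h1 := hC Set.univ Set.univ .univ .univ (by simp)
  rw [measure_univ, Set.univ_inter, Real.volume_Ioo,
    show Real.pi - -Real.pi = 2 * Real.pi by ring] at h1
  rw [hC A T hA hT h, ENNReal.eq_inv_of_mul_eq_one_left h1.symm, mul_comm, div_eq_mul_inv]

/-! ### The angle between a Gaussian vector and a fixed vector -/

/-- Splitting off the first coordinate of a standard Gaussian vector. -/
lemma lintegral_pi_gaussianReal_succ {n : ℕ} {F : ℝ × ℝ → ℝ≥0∞} (hF : Measurable F) :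
    ∫⁻ z : Fin (n + 1) → ℝ, F (z 0, √(∑ i : Fin n, z i.succ ^ 2))
        ∂(Measure.pi fun _ ↦ gaussianReal 0 1) =
      ∫⁻ u, ∫⁻ z : Fin n → ℝ, F (u, √(∑ i, z i ^ 2)) ∂(Measure.pi fun _ ↦ gaussianReal 0 1)
        ∂(gaussianReal 0 1) := by
  have hmp := measurePreserving_piFinSuccAbove (fun _ : Fin (n + 1) ↦ gaussianReal 0 1) 0
  have hm : Measurable fun p : ℝ × (Fin n → ℝ) ↦ F (p.1, √(∑ i, p.2 i ^ 2)) := by fun_prop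
  rw [← lintegral_prod _ hm.aemeasurable, ← hmp.lintegral_comp hm]
  rfl

/-- Up to a constant, the joint law of the first coordinate `u` of a Gaussian vector and of the norm
`v` of the other ones, in polar coordinates `u = r cos φ`, `v = r sin φ`, given that `v` has a
density proportional to `v ^ n * exp (-v ^ 2 / 2)`. -/
lemma lintegral_gaussian_polar_of_radial {n : ℕ} {C : ℝ≥0∞}
    (hC : ∀ g : ℝ → ℝ≥0∞, Measurable g →
      ∫⁻ z : Fin (n + 1) → ℝ, g √(∑ i, z i ^ 2) ∂(Measure.pi fun _ ↦ gaussianReal 0 1) =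
        C * ∫⁻ v in Set.Ioi (0 : ℝ), ENNReal.ofReal (v ^ n * Real.exp (-v ^ 2 / 2)) * g v)
    {F : ℝ × ℝ → ℝ≥0∞} (hF : Measurable F) :
    ∫⁻ z : Fin (n + 2) → ℝ, F (z 0, √(∑ i : Fin (n + 1), z i.succ ^ 2))
        ∂(Measure.pi fun _ ↦ gaussianReal 0 1) =
      ENNReal.ofReal (√(2 * Real.pi))⁻¹ * C *
        ∫⁻ r in Set.Ioi (0 : ℝ), ∫⁻ φ in Set.Ioo 0 Real.pi,
          ENNReal.ofReal (r ^ (n + 1) * Real.exp (-r ^ 2 / 2)) *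
            (ENNReal.ofReal (Real.sin φ ^ n) * F (r * Real.cos φ, r * Real.sin φ)) := by
  set H : ℝ × ℝ → ℝ≥0∞ := fun p ↦
    ENNReal.ofReal (p.2 ^ n * Real.exp (-(p.1 ^ 2 + p.2 ^ 2) / 2)) * F p with hH
  have hHm : Measurable H := by fun_prop
  rw [lintegral_pi_gaussianReal_succ hF]
  simp_rw [fun u ↦ hC (fun v ↦ F (u, v)) (by fun_prop)]
  rw [lintegral_gaussianReal_zero_one _ (by fun_prop), mul_assoc]
  congr 1
  have : ∀ u : ℝ, ENNReal.ofReal (Real.exp (-u ^ 2 / 2)) * (C * ∫⁻ v in Set.Ioi (0 : ℝ),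
      ENNReal.ofReal (v ^ n * Real.exp (-v ^ 2 / 2)) * F (u, v)) =
      C * ∫⁻ v in Set.Ioi (0 : ℝ), H (u, v) := by
    intro u
    rw [mul_left_comm, ← lintegral_const_mul _ (by fun_prop)]
    congr 1
    refine lintegral_congr fun v ↦ ?_
    simp only [hH]
    rw [← mul_assoc, ← ENNReal.ofReal_mul (by positivity), mul_left_comm, ← Real.exp_add]
    congr 5; ring
  simp_rw [this]
  rw [lintegral_const_mul _ (by fun_prop), lintegral_upperHalfPlane_polar hHm]
  congr 1
  refine setLIntegral_congr_fun measurableSet_Ioi fun r hr ↦ ?_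
  refine setLIntegral_congr_fun measurableSet_Ioo fun φ hφ ↦ ?_
  have hr : 0 < r := hr
  have hs := Real.sin_pos_of_mem_Ioo hφ
  simp only [hH]
  rw [← mul_assoc, ← mul_assoc, ← ENNReal.ofReal_mul hr.le, ← ENNReal.ofReal_mul (by positivity)]
  have hr2 : (r * Real.cos φ) ^ 2 + (r * Real.sin φ) ^ 2 = r ^ 2 := by
    rw [mul_pow, mul_pow, ← mul_add, Real.cos_sq_add_sin_sq, mul_one]
  rw [hr2]
  congr 2
  ring

/-- The norm of a standard Gaussian vector of dimension `n + 1` has a density proportional to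
`v ^ n * exp (-v ^ 2 / 2)`: adding one coordinate and integrating out the polar angle raises the
exponent by one. -/
lemma exists_lintegral_gaussian_radial (n : ℕ) : ∃ C : ℝ≥0∞, ∀ g : ℝ → ℝ≥0∞, Measurable g →
    ∫⁻ z : Fin (n + 1) → ℝ, g √(∑ i, z i ^ 2) ∂(Measure.pi fun _ ↦ gaussianReal 0 1) =
      C * ∫⁻ v in Set.Ioi (0 : ℝ), ENNReal.ofReal (v ^ n * Real.exp (-v ^ 2 / 2)) * g v := by
  induction n with
  | zero =>
    refine ⟨ENNReal.ofReal (√(2 * Real.pi))⁻¹ * 2, fun g hg ↦ ?_⟩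
    have h1 := lintegral_pi_gaussianReal_succ (n := 0) (F := fun p ↦ g √(p.1 ^ 2 + p.2 ^ 2))
      (by fun_prop)
    simp only [Finset.univ_eq_empty, Finset.sum_empty, Real.sqrt_zero, lintegral_const,
      measure_univ, mul_one, zero_pow two_ne_zero, add_zero] at h1
    have h2 : ∀ z : Fin (0 + 1) → ℝ, ∑ i, z i ^ 2 = z 0 ^ 2 := fun z ↦
      Fin.sum_univ_one fun i ↦ z i ^ 2
    simp only [h2, pow_zero, one_mul]
    rw [h1, lintegral_gaussianReal_zero_one _ (by fun_prop), mul_assoc]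
    congr 1
    set h : ℝ → ℝ≥0∞ := fun u ↦ ENNReal.ofReal (Real.exp (-u ^ 2 / 2)) * g √(u ^ 2) with hh
    have hpos : ∫⁻ u in Set.Ioi (0 : ℝ), h u =
        ∫⁻ v in Set.Ioi (0 : ℝ), ENNReal.ofReal (Real.exp (-v ^ 2 / 2)) * g v := by
      refine setLIntegral_congr_fun measurableSet_Ioi fun v hv ↦ ?_
      simp only [hh, Real.sqrt_sq (le_of_lt hv)]
    have hneg : ∫⁻ u in Set.Iio (0 : ℝ), h u = ∫⁻ u in Set.Ioi (0 : ℝ), h u := by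
      have := (Measure.measurePreserving_neg (volume : Measure ℝ)).setLIntegral_comp_preimage
        (s := Set.Ioi 0) measurableSet_Ioi (f := h) (by fun_prop)
      rw [← this]
      simp [hh]
    rw [← lintegral_add_compl _ (measurableSet_Ioi (a := (0 : ℝ))), Set.compl_Ioi,
      setLIntegral_congr Iio_ae_eq_Iic.symm, hneg, hpos, two_mul]
  | succ n ih =>
    obtain ⟨C, hC⟩ := ih
    refine ⟨ENNReal.ofReal (√(2 * Real.pi))⁻¹ * C *
      ∫⁻ φ in Set.Ioo 0 Real.pi, ENNReal.ofReal (Real.sin φ ^ n), fun g hg ↦ ?_⟩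
    have h1 := lintegral_gaussian_polar_of_radial hC (F := fun p ↦ g √(p.1 ^ 2 + p.2 ^ 2))
      (by fun_prop)
    have h2 : ∀ z : Fin (n + 2) → ℝ,
        √(z 0 ^ 2 + √(∑ i : Fin (n + 1), z i.succ ^ 2) ^ 2) = √(∑ i, z i ^ 2) := fun z ↦ by
      rw [Real.sq_sqrt (Finset.sum_nonneg fun _ _ ↦ sq_nonneg _), Fin.sum_univ_succ (n := n + 1)]
    simp only [h2] at h1
    rw [h1, mul_assoc _ (∫⁻ φ in _, _)]
    congr 1
    rw [← lintegral_const_mul _ (by fun_prop)]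
    refine setLIntegral_congr_fun measurableSet_Ioi fun r hr ↦ ?_
    have hr : 0 < r := hr
    rw [← lintegral_mul_const _ (by fun_prop)]
    refine lintegral_congr fun φ ↦ ?_
    rw [show (r * Real.cos φ) ^ 2 + (r * Real.sin φ) ^ 2 = r ^ 2 by
      rw [mul_pow, mul_pow, ← mul_add, Real.cos_sq_add_sin_sq, mul_one], Real.sqrt_sq hr.le]
    ring

lemma exists_orthonormalBasis_zero_eq {n : ℕ} {x : EuclideanSpace ℝ (Fin (n + 1))}
    (hx : ‖x‖ = 1) :
    ∃ b : OrthonormalBasis (Fin (n + 1)) ℝ (EuclideanSpace ℝ (Fin (n + 1))), b 0 = x := by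
  have : Orthonormal ℝ (Set.domRestrict {0} fun _ : Fin (n + 1) ↦ x) := by
    refine ⟨fun _ ↦ hx, fun i j hij ↦ (hij (Subsingleton.elim _ _)).elim⟩
  obtain ⟨b, hb⟩ := this.exists_orthonormalBasis_extension_of_card_eq (by simp)
  exact ⟨b, hb 0 rfl⟩

lemma measurable_angle {D : ℕ} : Measurable fun p : EuclideanSpace ℝ (Fin D) ×
    EuclideanSpace ℝ (Fin D) ↦ InnerProductGeometry.angle p.1 p.2 := by
  unfold InnerProductGeometry.angle
  fun_prop

lemma measurable_angle_right {D : ℕ} (x : EuclideanSpace ℝ (Fin D)) :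
    Measurable fun y ↦ InnerProductGeometry.angle x y := by
  unfold InnerProductGeometry.angle
  fun_prop

/-- The angle between the first vector of an orthonormal basis and a vector, in coordinates. -/
lemma OrthonormalBasis.angle_zero_sum {n : ℕ} {E : Type*} [NormedAddCommGroup E]
    [InnerProductSpace ℝ E] (b : OrthonormalBasis (Fin (n + 1)) ℝ E) (z : Fin (n + 1) → ℝ) :
    InnerProductGeometry.angle (b 0) (∑ i, z i • b i) =
      Real.arccos (z 0 / √(z 0 ^ 2 + √(∑ i : Fin n, z i.succ ^ 2) ^ 2)) := by
  have h1 : inner ℝ (b 0) (∑ i, z i • b i) = z 0 := b.orthonormal.inner_right_fintype z 0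
  have h2 : ‖∑ i, z i • b i‖ = √(∑ i, z i ^ 2) := by
    rw [← Real.sqrt_sq (norm_nonneg (∑ i, z i • b i)), ← real_inner_self_eq_norm_sq,
      b.orthonormal.inner_sum]
    simp [sq]
  rw [InnerProductGeometry.angle, b.norm_eq_one, one_mul, h1, h2,
    Real.sq_sqrt (Finset.sum_nonneg fun _ _ ↦ sq_nonneg _), Fin.sum_univ_succ]

/-- The angle between a fixed nonzero vector and a standard Gaussian vector of dimension `n + 2` has
a density proportional to `sin ^ n` on `(0, π)`. -/
lemma exists_lintegral_angle_stdGaussian (n : ℕ) : ∃ K : ℝ≥0∞, K ≠ 0 ∧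
    ∀ x : EuclideanSpace ℝ (Fin (n + 2)), x ≠ 0 → ∀ g : ℝ → ℝ≥0∞, Measurable g →
      ∫⁻ y, g (InnerProductGeometry.angle x y) ∂(stdGaussian (EuclideanSpace ℝ (Fin (n + 2)))) =
        K * ∫⁻ φ in Set.Ioo 0 Real.pi, ENNReal.ofReal (Real.sin φ ^ n) * g φ := by
  obtain ⟨C, hC⟩ := exists_lintegral_gaussian_radial n
  obtain ⟨K, hK⟩ : ∃ K : ℝ≥0∞, ∀ x : EuclideanSpace ℝ (Fin (n + 2)), x ≠ 0 →
      ∀ g : ℝ → ℝ≥0∞, Measurable g →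
      ∫⁻ y, g (InnerProductGeometry.angle x y) ∂(stdGaussian (EuclideanSpace ℝ (Fin (n + 2)))) =
        K * ∫⁻ φ in Set.Ioo 0 Real.pi, ENNReal.ofReal (Real.sin φ ^ n) * g φ := by
    refine ⟨ENNReal.ofReal (√(2 * Real.pi))⁻¹ * C * ∫⁻ r in Set.Ioi (0 : ℝ),
      ENNReal.ofReal (r ^ (n + 1) * Real.exp (-r ^ 2 / 2)), fun x hx g hg ↦ ?_⟩
    have hx' : 0 < ‖x‖ := norm_pos_iff.2 hx
    obtain ⟨b, hb⟩ := exists_orthonormalBasis_zero_eq (x := ‖x‖⁻¹ • x) (by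
      rw [norm_smul, norm_inv, norm_norm, inv_mul_cancel₀ hx'.ne'])
    have hm : Measurable fun y ↦ g (InnerProductGeometry.angle x y) :=
      hg.comp (measurable_angle_right x)
    rw [stdGaussian_eq_map_pi_orthonormalBasis b, lintegral_map hm (by fun_prop)]
    have hang : ∀ z : Fin (n + 2) → ℝ, InnerProductGeometry.angle x (∑ i, z i • b i) =
        Real.arccos (z 0 / √(z 0 ^ 2 + √(∑ i : Fin (n + 1), z i.succ ^ 2) ^ 2)) := by
      intro z
      rw [← InnerProductGeometry.angle_smul_left_of_pos x _ (inv_pos.2 hx'), ← hb,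
        b.angle_zero_sum]
    simp_rw [hang]
    rw [lintegral_gaussian_polar_of_radial hC
      (F := fun p ↦ g (Real.arccos (p.1 / √(p.1 ^ 2 + p.2 ^ 2)))) (by fun_prop),
      mul_assoc _ (∫⁻ r in _, _), ← lintegral_mul_const _ (by fun_prop)]
    congr 1
    refine setLIntegral_congr_fun measurableSet_Ioi fun r hr ↦ ?_
    have hr : 0 < r := hr
    rw [← lintegral_const_mul _ (by fun_prop)]
    refine setLIntegral_congr_fun measurableSet_Ioo fun φ hφ ↦ ?_
    rw [show (r * Real.cos φ) ^ 2 + (r * Real.sin φ) ^ 2 = r ^ 2 by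
      rw [mul_pow, mul_pow, ← mul_add, Real.cos_sq_add_sin_sq, mul_one], Real.sqrt_sq hr.le,
      mul_div_cancel_left₀ _ hr.ne', Real.arccos_cos hφ.1.le hφ.2.le]
  -- with `K = 0` the total mass `g = 1` would vanish
  refine ⟨K, fun h0 ↦ ?_, hK⟩
  obtain ⟨x, hx⟩ := exists_ne (0 : EuclideanSpace ℝ (Fin (n + 2)))
  have := hK x hx 1 measurable_one
  simp [h0] at this

/-! ### The probability that a random hyperplane does not separate two vectors -/

/-- The class of `a`, positive or nonpositive, is predicted by the strict sign of `b`. The asymmetry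
at `a = 0` is that of `hashSign`, which sends `0` to `0`. -/
def SignsAgree (a b : ℝ) : Prop := (0 < a ∧ 0 < b) ∨ (a ≤ 0 ∧ b < 0)

lemma measurableSet_signsAgree : MeasurableSet {p : ℝ × ℝ | SignsAgree p.1 p.2} :=
  ((measurableSet_lt measurable_const measurable_fst).inter
    (measurableSet_lt measurable_const measurable_snd)).union
  ((measurableSet_le measurable_fst measurable_const).inter
    (measurableSet_lt measurable_snd measurable_const))

lemma signsAgree_mul_iff {c : ℝ} (hc : 0 < c) {d : ℝ} (hd : 0 < d) {a b : ℝ} :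
    SignsAgree (c * a) (d * b) ↔ SignsAgree a b := by
  simp only [SignsAgree, mul_pos_iff_of_pos_left hc, mul_pos_iff_of_pos_left hd,
    mul_nonpos_iff_pos_imp_nonpos, mul_neg_iff, hc, hd, hd.not_gt]
  have : a ≤ 0 → c * a ≤ 0 := fun h ↦ by nlinarith
  grind

/-- The half planes of the angles within `π / 2` of `0` and of `θ` meet in a wedge of opening
`π - θ`. -/
lemma gaussianReal_prod_wedge {θ : ℝ} (h0 : 0 ≤ θ) (hπ : θ ≤ Real.pi) :
    ((gaussianReal 0 1).prod (gaussianReal 0 1))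
      {p | 0 < p.1 ∧ 0 < Real.cos θ * p.1 + Real.sin θ * p.2} =
        ENNReal.ofReal (Real.pi - θ) / ENNReal.ofReal (2 * Real.pi) := by
  have hpi := Real.pi_pos
  rw [gaussianReal_prod_of_angular (T := Set.Ioo (θ - Real.pi / 2) (Real.pi / 2)) ?_
    measurableSet_Ioo ?_]
  · rw [Set.inter_eq_left.2 (Set.Ioo_subset_Ioo (by linarith) (by linarith)), Real.volume_Ioo]
    congr 2; ring
  · have hq : Measurable fun p : ℝ × ℝ ↦ Real.cos θ * p.1 + Real.sin θ * p.2 := by fun_prop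
    exact (measurableSet_lt measurable_const measurable_fst).inter
      (measurableSet_lt measurable_const hq)
  · intro r hr φ hφ
    have : Real.cos θ * (r * Real.cos φ) + Real.sin θ * (r * Real.sin φ) =
        r * Real.cos (φ - θ) := by
      rw [Real.cos_sub]; ring
    simp only [Set.mem_ofPred_eq, this, mul_pos_iff_of_pos_left hr, Set.mem_Ioo]
    obtain ⟨h1, h2⟩ := hφ
    constructor
    · rintro ⟨hc, hc'⟩
      have hlt : φ < Real.pi / 2 := by
        by_contra! h
        exact hc.not_ge (Real.cos_nonpos_of_pi_div_two_le_of_le h (by linarith))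
      have hgt : -(Real.pi / 2) < φ := by
        by_contra! h
        rw [← Real.cos_neg] at hc
        exact hc.not_ge (Real.cos_nonpos_of_pi_div_two_le_of_le (by linarith) (by linarith))
      refine ⟨?_, hlt⟩
      by_contra! h
      rw [← Real.cos_neg] at hc'
      exact hc'.not_ge (Real.cos_nonpos_of_pi_div_two_le_of_le (by linarith) (by linarith))
    · rintro ⟨h3, h4⟩
      exact ⟨Real.cos_pos_of_mem_Ioo ⟨by linarith, h4⟩,
        Real.cos_pos_of_mem_Ioo ⟨by linarith, by linarith⟩⟩

lemma gaussianReal_prod_signsAgree {θ : ℝ} (h0 : 0 ≤ θ) (hπ : θ ≤ Real.pi) :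
    ((gaussianReal 0 1).prod (gaussianReal 0 1))
      {p | SignsAgree p.1 (Real.cos θ * p.1 + Real.sin θ * p.2)} =
        ENNReal.ofReal (1 - θ / Real.pi) := by
  have hpi := Real.pi_pos
  set μ := (gaussianReal 0 1).prod (gaussianReal 0 1) with hμ
  have hq : Measurable fun p : ℝ × ℝ ↦ Real.cos θ * p.1 + Real.sin θ * p.2 := by fun_prop
  have hmneg : MeasurableSet {p : ℝ × ℝ | p.1 ≤ 0 ∧ Real.cos θ * p.1 + Real.sin θ * p.2 < 0} :=
    (measurableSet_le measurable_fst measurable_const).inter (measurableSet_lt hq measurable_const)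
  have hmpos : MeasurableSet {p : ℝ × ℝ | 0 < p.1 ∧ 0 < Real.cos θ * p.1 + Real.sin θ * p.2} :=
    (measurableSet_lt measurable_const measurable_fst).inter (measurableSet_lt measurable_const hq)
  have hmp : MeasurePreserving (Prod.map (fun x : ℝ ↦ -x) (fun x : ℝ ↦ -x)) μ μ := by
    have : MeasurePreserving (fun x : ℝ ↦ -x) (gaussianReal 0 1) (gaussianReal 0 1) :=
      ⟨measurable_neg, by rw [gaussianReal_map_neg, neg_zero]⟩
    exact this.prod this
  have hnull : ∀ᵐ p ∂μ, p.1 ≠ 0 := by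
    have : NullSingletonClass (gaussianReal 0 1) := nullSingletonClass_gaussianReal one_ne_zero
    exact Measure.quasiMeasurePreserving_fst.ae (Measure.ae_ne (gaussianReal 0 1) (0 : ℝ))
  -- the central symmetry exchanges the two wedges, up to the line `p.1 = 0`
  have hneg : μ {p | p.1 ≤ 0 ∧ Real.cos θ * p.1 + Real.sin θ * p.2 < 0} =
      μ {p | 0 < p.1 ∧ 0 < Real.cos θ * p.1 + Real.sin θ * p.2} := by
    rw [← hmp.measure_preimage hmpos.nullMeasurableSet]
    refine measure_congr ?_
    filter_upwards [hnull] with p hp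
    refine propext ?_
    change (p.1 ≤ 0 ∧ Real.cos θ * p.1 + Real.sin θ * p.2 < 0) ↔
      (0 < -p.1 ∧ 0 < Real.cos θ * -p.1 + Real.sin θ * -p.2)
    refine and_congr ?_ ?_
    · rw [neg_pos]; exact ⟨fun h ↦ lt_of_le_of_ne h hp, le_of_lt⟩
    · constructor <;> intro h <;> linarith
  have hun : {p : ℝ × ℝ | SignsAgree p.1 (Real.cos θ * p.1 + Real.sin θ * p.2)} =
      {p | 0 < p.1 ∧ 0 < Real.cos θ * p.1 + Real.sin θ * p.2} ∪
        {p | p.1 ≤ 0 ∧ Real.cos θ * p.1 + Real.sin θ * p.2 < 0} := rfl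
  rw [hun, measure_union _ hmneg, hneg, gaussianReal_prod_wedge h0 hπ,
    ← ENNReal.ofReal_div_of_pos (by positivity),
    ← ENNReal.ofReal_add (div_nonneg (by linarith) (by positivity))
      (div_nonneg (by linarith) (by positivity))]
  · congr 1; field_simp; ring
  · rw [Set.disjoint_left]
    rintro p ⟨h1, -⟩ ⟨h2, -⟩
    exact h2.not_gt h1

lemma map_pi_gaussianReal_pair (n : ℕ) :
    (Measure.pi fun _ : Fin (n + 2) ↦ gaussianReal 0 1).map (fun z ↦ (z 0, z 1)) =
      (gaussianReal 0 1).prod (gaussianReal 0 1) := by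
  have h := iIndepFun_pi (μ := fun _ : Fin (n + 2) ↦ gaussianReal 0 1) (X := fun _ x ↦ x)
    (fun _ ↦ aemeasurable_id)
  have h2 := (h.indepFun (zero_ne_one : (0 : Fin (n + 2)) ≠ 1)).map_prod_eq_prod_map_map
    (measurable_pi_apply 0).aemeasurable (measurable_pi_apply 1).aemeasurable
  rw [h2, (measurePreserving_eval _ 0).map_eq, (measurePreserving_eval _ 1).map_eq]

/-- Two unit vectors span a plane that has an orthonormal basis in which the first one has angle `0`
and the second one has their angle; it extends to an orthonormal basis of the space. -/
lemma exists_orthonormalBasis_angle {n : ℕ} {x y : EuclideanSpace ℝ (Fin (n + 2))}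
    (hx : ‖x‖ = 1) (hy : ‖y‖ = 1) :
    ∃ b : OrthonormalBasis (Fin (n + 2)) ℝ (EuclideanSpace ℝ (Fin (n + 2))), b 0 = x ∧
      y = Real.cos (InnerProductGeometry.angle x y) • b 0 +
        Real.sin (InnerProductGeometry.angle x y) • b 1 := by
  set θ := InnerProductGeometry.angle x y with hθ
  have hin : inner ℝ x y = Real.cos θ := by
    have := InnerProductGeometry.cos_angle_mul_norm_mul_norm x y
    rw [hx, hy] at this
    linarith
  have hxx : inner ℝ x x = (1 : ℝ) := by rw [real_inner_self_eq_norm_sq, hx, one_pow]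
  have hperp : inner ℝ x (y - Real.cos θ • x) = (0 : ℝ) := by
    rw [inner_sub_right, inner_smul_right, hin, hxx]; ring
  have hnorm : ‖y - Real.cos θ • x‖ ^ 2 = Real.sin θ ^ 2 := by
    rw [norm_sub_sq_real, inner_smul_right, real_inner_comm, hin, norm_smul, hx, hy,
      Real.norm_eq_abs, mul_one, sq_abs, Real.sin_sq]
    ring
  have hs0 : 0 ≤ Real.sin θ := InnerProductGeometry.sin_angle_nonneg x y
  have hnorm' : ‖y - Real.cos θ • x‖ = Real.sin θ := by
    rwa [sq_eq_sq₀ (norm_nonneg _) hs0] at hnorm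
  obtain ⟨e, he, hxe, hye⟩ : ∃ e : EuclideanSpace ℝ (Fin (n + 2)), ‖e‖ = 1 ∧ inner ℝ x e = (0 : ℝ) ∧
      y = Real.cos θ • x + Real.sin θ • e := by
    -- parallel vectors: the second basis vector does not matter
    rcases hs0.eq_or_lt with hs | hs
    · obtain ⟨b, hb⟩ := exists_orthonormalBasis_zero_eq hx
      refine ⟨b 1, b.norm_eq_one 1, ?_, ?_⟩
      · rw [← hb]; exact b.orthonormal.2 zero_ne_one
      · rw [← hs, zero_smul, add_zero, ← sub_eq_zero, ← norm_eq_zero, hnorm', hs]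
    · refine ⟨(Real.sin θ)⁻¹ • (y - Real.cos θ • x), ?_, ?_, ?_⟩
      · rw [norm_smul, hnorm', norm_inv, Real.norm_of_nonneg hs0, inv_mul_cancel₀ hs.ne']
      · rw [inner_smul_right, hperp, mul_zero]
      · rw [smul_inv_smul₀ hs.ne']; abel
  have horth : Orthonormal ℝ
      (Set.domRestrict {0, 1} fun i : Fin (n + 2) ↦ if i = 0 then x else e) := by
    refine ⟨?_, ?_⟩
    · rintro ⟨i, rfl | rfl⟩ <;> simp [Set.domRestrict, hx, he]
    · rintro ⟨i, rfl | rfl⟩ ⟨j, rfl | rfl⟩ hij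
      · exact (hij rfl).elim
      · simpa [Set.domRestrict] using hxe
      · simpa [Set.domRestrict, real_inner_comm] using hxe
      · exact (hij rfl).elim
  obtain ⟨b, hb⟩ := horth.exists_orthonormalBasis_extension_of_card_eq (by simp)
  have hb0 : b 0 = x := by simpa using hb 0 (by simp)
  have hb1 : b 1 = e := by simpa using hb 1 (by simp)
  exact ⟨b, hb0, by rw [hb0, hb1]; exact hye⟩

/-- A standard Gaussian hyperplane puts two nonzero vectors on the same side with probability
`1 - θ / π`, where `θ` is their angle: only the projection to their plane matters. -/
lemma stdGaussian_signsAgree {n : ℕ} {x y : EuclideanSpace ℝ (Fin (n + 2))}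
    (hx : x ≠ 0) (hy : y ≠ 0) :
    stdGaussian (EuclideanSpace ℝ (Fin (n + 2))) {w | SignsAgree (inner ℝ w x) (inner ℝ w y)} =
      ENNReal.ofReal (1 - InnerProductGeometry.angle x y / Real.pi) := by
  have hx' : 0 < ‖x‖ := norm_pos_iff.2 hx
  have hy' : 0 < ‖y‖ := norm_pos_iff.2 hy
  obtain ⟨b, hb, hyb⟩ := exists_orthonormalBasis_angle (x := ‖x‖⁻¹ • x) (y := ‖y‖⁻¹ • y)
    (by rw [norm_smul, norm_inv, norm_norm, inv_mul_cancel₀ hx'.ne'])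
    (by rw [norm_smul, norm_inv, norm_norm, inv_mul_cancel₀ hy'.ne'])
  rw [InnerProductGeometry.angle_smul_left_of_pos _ _ (inv_pos.2 hx'),
    InnerProductGeometry.angle_smul_right_of_pos _ _ (inv_pos.2 hy')] at hyb
  set θ := InnerProductGeometry.angle x y
  have hset : MeasurableSet {w : EuclideanSpace ℝ (Fin (n + 2)) |
      SignsAgree (inner ℝ w x) (inner ℝ w y)} :=
    measurableSet_signsAgree.preimage
      (f := fun w : EuclideanSpace ℝ (Fin (n + 2)) ↦ (inner ℝ w x, inner ℝ w y)) (by fun_prop)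
  have hset2 : MeasurableSet {p : ℝ × ℝ | SignsAgree p.1 (Real.cos θ * p.1 + Real.sin θ * p.2)} :=
    measurableSet_signsAgree.preimage
      (f := fun p : ℝ × ℝ ↦ (p.1, Real.cos θ * p.1 + Real.sin θ * p.2)) (by fun_prop)
  rw [← gaussianReal_prod_signsAgree (InnerProductGeometry.angle_nonneg x y)
    (InnerProductGeometry.angle_le_pi x y), ← map_pi_gaussianReal_pair n,
    Measure.map_apply (by fun_prop) hset2, stdGaussian_eq_map_pi_orthonormalBasis b,
    Measure.map_apply (by fun_prop) hset]
  congr 1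
  ext z
  have hc : ∀ i, inner ℝ (∑ j, z j • b j) (b i) = z i := fun i ↦ by
    rw [real_inner_comm]; exact b.orthonormal.inner_right_fintype z i
  have h1 : inner ℝ (∑ j, z j • b j) x = ‖x‖ * z 0 := by
    rw [← hc 0, hb, inner_smul_right, mul_inv_cancel_left₀ hx'.ne']
  have h2 : inner ℝ (∑ j, z j • b j) y = ‖y‖ * (Real.cos θ * z 0 + Real.sin θ * z 1) := by
    rw [← hc 0, ← hc 1, ← inner_smul_right, ← inner_smul_right, ← inner_add_right, ← hyb,
      inner_smul_right, mul_inv_cancel_left₀ hy'.ne']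
  change SignsAgree _ _ ↔ SignsAgree _ _
  rw [h1, h2, signsAgree_mul_iff hx' hy']

/-! ### The loss threshold and the law of the hash vectors -/

/-- The cross entropy is below `log 2` exactly if the sigmoid prediction is on the correct side of
`1 / 2`. -/
lemma hashLoss_zero_lt_log_two_iff {D : ℕ} (w ft fs : EuclideanSpace ℝ (Fin D)) :
    hashLoss w 0 ft fs < Real.log 2 ↔ SignsAgree (inner ℝ w ft) (inner ℝ w fs) := by
  have key : ∀ t : ℝ, -Real.log (Real.sigmoid t) < Real.log 2 ↔ 0 < t := fun t ↦ by
    rw [← Real.sigmoid_lt_iff (a := 0), Real.sigmoid_zero, neg_lt, ← Real.log_inv,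
      Real.log_lt_log_iff (by norm_num) (Real.sigmoid_pos t)]
  simp only [hashLoss, hashCode, hashPred, hashSign, SignsAgree, add_zero, ← Real.sigmoid_neg]
  split_ifs with h
  · have := key (inner ℝ w fs)
    simp only [neg_mul, one_mul, sub_self, zero_mul, sub_zero, this, h, h.not_ge]
    tauto
  · have := key (-inner ℝ w fs)
    simp only [neg_zero, zero_mul, sub_zero, one_mul, zero_sub, this, h, not_lt.1 h, neg_pos]
    tauto

lemma multivariateGaussian_zero_sq_smul_one (D : ℕ) (s : ℝ) :
    multivariateGaussian 0 ((s ^ 2) • (1 : Matrix (Fin D) (Fin D) ℝ)) =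
      (stdGaussian (EuclideanSpace ℝ (Fin D))).map (s • ·) := by
  apply Measure.ext_of_charFun
  ext t
  have h : t ⬝ᵥ ((s ^ 2) • (1 : Matrix (Fin D) (Fin D) ℝ)).mulVec t = ‖s • t‖ ^ 2 := by
    rw [Matrix.smul_mulVec, Matrix.one_mulVec, dotProduct_smul, norm_smul, mul_pow,
      Real.norm_eq_abs, sq_abs, EuclideanSpace.real_norm_sq_eq, smul_eq_mul]
    simp [dotProduct, sq]
  rw [charFun_map_smul, charFun_stdGaussian,
    charFun_multivariateGaussian (Matrix.PosSemidef.one.smul (sq_nonneg s)), h]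
  simp [neg_div]

lemma measurableSet_inner_signsAgree {D : ℕ} (x y : EuclideanSpace ℝ (Fin D)) :
    MeasurableSet {w : EuclideanSpace ℝ (Fin D) | SignsAgree (inner ℝ w x) (inner ℝ w y)} :=
  measurableSet_signsAgree.preimage
    (f := fun w : EuclideanSpace ℝ (Fin D) ↦ (inner ℝ w x, inner ℝ w y)) (by fun_prop)

lemma multivariateGaussian_signsAgree {n : ℕ} {s : ℝ} (hs : 0 < s)
    {x y : EuclideanSpace ℝ (Fin (n + 2))} (hx : x ≠ 0) (hy : y ≠ 0) :
    multivariateGaussian 0 ((s ^ 2) • (1 : Matrix (Fin (n + 2)) (Fin (n + 2)) ℝ))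
      {w | SignsAgree (inner ℝ w x) (inner ℝ w y)} =
      ENNReal.ofReal (1 - InnerProductGeometry.angle x y / Real.pi) := by
  rw [multivariateGaussian_zero_sq_smul_one,
    Measure.map_apply (by fun_prop) (measurableSet_inner_signsAgree x y),
    ← stdGaussian_signsAgree hx hy]
  congr 1
  ext w
  change SignsAgree (inner ℝ (s • w) x) (inner ℝ (s • w) y) ↔ SignsAgree _ _
  rw [real_inner_smul_left, real_inner_smul_left, signsAgree_mul_iff hs hs]

lemma ae_stdGaussian_ne_zero (n : ℕ) :
    ∀ᵐ x ∂(stdGaussian (EuclideanSpace ℝ (Fin (n + 1)))), x ≠ 0 := by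
  have : NullSingletonClass (gaussianReal 0 1) := nullSingletonClass_gaussianReal one_ne_zero
  rw [← map_pi_eq_stdGaussian, ae_map_iff (p := fun x ↦ x ≠ 0) (by fun_prop)
    (measurableSet_singleton 0).compl]
  have h := (Measure.quasiMeasurePreserving_eval (fun _ : Fin (n + 1) ↦ gaussianReal 0 1) 0).ae
    (Measure.ae_ne (gaussianReal 0 1) (0 : ℝ))
  filter_upwards [h] with z hz h0
  exact hz (by simpa using congrArg (fun v : EuclideanSpace ℝ (Fin (n + 1)) ↦ v 0) h0)

/-! ### The joint law of the event and the angle -/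

/-- The event that all hash functions agree on the two features and that the angle lies in `B`. -/
def agreeAngleSet (D N : ℕ) (B : Set ℝ) : Set ((EuclideanSpace ℝ (Fin D) ×
    EuclideanSpace ℝ (Fin D)) × (Fin N → EuclideanSpace ℝ (Fin D))) :=
  {q | (∀ j, SignsAgree (inner ℝ (q.2 j) q.1.1) (inner ℝ (q.2 j) q.1.2)) ∧
    InnerProductGeometry.angle q.1.1 q.1.2 ∈ B}

lemma measurableSet_agreeAngleSet (D N : ℕ) {B : Set ℝ} (hB : MeasurableSet B) :
    MeasurableSet (agreeAngleSet D N B) := by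
  refine MeasurableSet.inter
    (measurableSet_setOfPred.2 (Measurable.forall fun j ↦ measurableSet_setOfPred.1 ?_))
    (hB.preimage (measurable_angle.comp measurable_fst))
  refine measurableSet_signsAgree.preimage
    (f := fun q : (EuclideanSpace ℝ (Fin D) × EuclideanSpace ℝ (Fin D)) ×
      (Fin N → EuclideanSpace ℝ (Fin D)) ↦ (inner ℝ (q.2 j) q.1.1, inner ℝ (q.2 j) q.1.2)) ?_
  fun_prop

/-- Given the features, the hash functions agree independently of each other, with probability
`1 - θ / π` each. Averaging over the features weights `θ` with a multiple of `sin ^ n`. -/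
lemma exists_measure_agreeAngleSet (n N : ℕ) {s : ℝ} (hs : 0 < s) : ∃ K : ℝ≥0∞, K ≠ 0 ∧
    ∀ B : Set ℝ, MeasurableSet B →
      (((stdGaussian (EuclideanSpace ℝ (Fin (n + 2)))).prod
        (stdGaussian (EuclideanSpace ℝ (Fin (n + 2))))).prod (Measure.pi fun _ : Fin N ↦
          multivariateGaussian 0 ((s ^ 2) • (1 : Matrix (Fin (n + 2)) (Fin (n + 2)) ℝ))))
        (agreeAngleSet (n + 2) N B) =
      K * ∫⁻ φ in B ∩ Set.Ioo 0 Real.pi,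
        ENNReal.ofReal ((1 - φ / Real.pi) ^ N * Real.sin φ ^ n) := by
  obtain ⟨K, hK0, hK⟩ := exists_lintegral_angle_stdGaussian n
  refine ⟨K, hK0, fun B hB ↦ ?_⟩
  set σ := stdGaussian (EuclideanSpace ℝ (Fin (n + 2))) with hσ
  set G : ℝ → ℝ≥0∞ := B.indicator fun φ ↦ ENNReal.ofReal (1 - φ / Real.pi) ^ N with hG
  have hGm : Measurable G := Measurable.indicator (by fun_prop) hB
  have hslice : ∀ᵐ p ∂(σ.prod σ), (Measure.pi fun _ : Fin N ↦
      multivariateGaussian 0 ((s ^ 2) • (1 : Matrix (Fin (n + 2)) (Fin (n + 2)) ℝ)))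
        (Prod.mk p ⁻¹' agreeAngleSet (n + 2) N B) = G (InnerProductGeometry.angle p.1 p.2) := by
    filter_upwards [Measure.quasiMeasurePreserving_fst.ae (ae_stdGaussian_ne_zero (n + 1)),
      Measure.quasiMeasurePreserving_snd.ae (ae_stdGaussian_ne_zero (n + 1))] with p h1 h2
    by_cases hp : InnerProductGeometry.angle p.1 p.2 ∈ B
    · have : Prod.mk p ⁻¹' agreeAngleSet (n + 2) N B = Set.univ.pi fun _ : Fin N ↦
          {w | SignsAgree (inner ℝ w p.1) (inner ℝ w p.2)} := by
        ext w
        simp [agreeAngleSet, hp]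
      rw [this, Measure.pi_pi, hG, Set.indicator_of_mem hp, Finset.prod_const,
        multivariateGaussian_signsAgree hs h1 h2, Finset.card_univ, Fintype.card_fin]
    · have : Prod.mk p ⁻¹' agreeAngleSet (n + 2) N B = ∅ := by
        ext w
        simp [agreeAngleSet, hp]
      rw [this, measure_empty, hG, Set.indicator_of_notMem hp]
  have hGa : Measurable fun p : EuclideanSpace ℝ (Fin (n + 2)) × EuclideanSpace ℝ (Fin (n + 2)) ↦
      G (InnerProductGeometry.angle p.1 p.2) := hGm.comp measurable_angle
  rw [Measure.prod_apply (measurableSet_agreeAngleSet _ _ hB), lintegral_congr_ae hslice,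
    lintegral_prod _ hGa.aemeasurable,
    lintegral_congr_ae ((ae_stdGaussian_ne_zero (n + 1)).mono fun x hx ↦ hK x hx G hGm),
    lintegral_const, measure_univ, mul_one, ← Measure.restrict_restrict hB,
    ← lintegral_indicator hB]
  congr 1
  refine setLIntegral_congr_fun measurableSet_Ioo fun φ hφ ↦ ?_
  have hφ' : 0 ≤ 1 - φ / Real.pi := sub_nonneg.2 ((div_le_one Real.pi_pos).2 hφ.2.le)
  simp only [hG, Set.indicator]
  split_ifs
  · rw [mul_comm, ENNReal.ofReal_mul (pow_nonneg hφ' N), ENNReal.ofReal_pow hφ']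
  · rw [mul_zero]

lemma one_sub_div_pi_pow_mul_sin_pow_pos (n N : ℕ) {φ : ℝ} (hφ : φ ∈ Set.Ioo 0 Real.pi) :
    0 < (1 - φ / Real.pi) ^ N * Real.sin φ ^ n :=
  mul_pos (pow_pos (sub_pos.2 ((div_lt_one Real.pi_pos).2 hφ.2)) N)
    (pow_pos (Real.sin_pos_of_mem_Ioo hφ) n)

lemma lintegral_Ioo_eq_ofReal_intervalIntegral (n N : ℕ) {ε : ℝ} (h0 : 0 ≤ ε)
    (hε : ε ≤ Real.pi) :
    ∫⁻ φ in Set.Ioo 0 ε, ENNReal.ofReal ((1 - φ / Real.pi) ^ N * Real.sin φ ^ n) =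
      ENNReal.ofReal (∫ φ in (0 : ℝ)..ε, (1 - φ / Real.pi) ^ N * Real.sin φ ^ n) := by
  have hc : Continuous fun φ : ℝ ↦ (1 - φ / Real.pi) ^ N * Real.sin φ ^ n := by fun_prop
  rw [intervalIntegral.integral_of_le h0, integral_Ioc_eq_integral_Ioo,
    ofReal_integral_eq_lintegral_ofReal]
  · exact (hc.integrableOn_Icc (a := 0) (b := ε)).mono_set Set.Ioo_subset_Icc_self
  · filter_upwards [ae_restrict_mem measurableSet_Ioo] with φ hφ
    exact (one_sub_div_pi_pow_mul_sin_pow_pos n N ⟨hφ.1, hφ.2.trans_le hε⟩).le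

theorem claim4 {Ω : Type*} [MeasurableSpace Ω] (P : Measure Ω) [IsProbabilityMeasure P]
    (D N : ℕ) (hD : 2 ≤ D) (s : ℝ) (hs : 0 < s)
    (ft fs : Ω → EuclideanSpace ℝ (Fin D))
    (w : Fin N → Ω → EuclideanSpace ℝ (Fin D))
    (b : Fin N → ℝ) (hb : b = 0)
    -- the features are standard Gaussian, the entries of the hash vectors are `N(0, s²)`
    (hft : HasLaw ft (stdGaussian (EuclideanSpace ℝ (Fin D))) P)
    (hfs : HasLaw fs (stdGaussian (EuclideanSpace ℝ (Fin D))) P)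
    (hw : ∀ j, HasLaw (w j)
      (multivariateGaussian 0 ((s ^ 2) • (1 : Matrix (Fin D) (Fin D) ℝ))) P)
    -- `f_t, f_s, w_1, …, w_N` are mutually independent
    (hf_indep : IndepFun ft fs P)
    (hw_indep : iIndepFun w P)
    (hfw_indep : IndepFun (fun ω => (ft ω, fs ω)) (fun ω j => w j ω) P)
    (ε : ℝ) (hε₀ : 0 < ε) (hεπ : ε < Real.pi) :
    -- the conditioning event has positive probability and the denominator is positive
    0 < P {ω | ∀ j, hashLoss (w j ω) (b j) (ft ω) (fs ω) < Real.log 2} ∧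
    0 < ∫ θ in (0 : ℝ)..Real.pi, (1 - θ / Real.pi) ^ N * Real.sin θ ^ (D - 2) ∧
    (P[|{ω | ∀ j, hashLoss (w j ω) (b j) (ft ω) (fs ω) < Real.log 2}]).real
        {ω | InnerProductGeometry.angle (ft ω) (fs ω) < ε} =
      (∫ θ in (0 : ℝ)..ε, (1 - θ / Real.pi) ^ N * Real.sin θ ^ (D - 2)) /
        (∫ θ in (0 : ℝ)..Real.pi, (1 - θ / Real.pi) ^ N * Real.sin θ ^ (D - 2)) := by
  obtain ⟨n, rfl⟩ : ∃ n, D = n + 2 := ⟨D - 2, by omega⟩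
  subst hb
  simp only [Pi.zero_apply, hashLoss_zero_lt_log_two_iff, Nat.add_sub_cancel]
  set f : ℝ → ℝ := fun θ ↦ (1 - θ / Real.pi) ^ N * Real.sin θ ^ n with hf
  have hfc : Continuous f := by fun_prop
  have hIpos : 0 < ∫ θ in (0 : ℝ)..Real.pi, f θ :=
    intervalIntegral.intervalIntegral_pos_of_pos_on (hfc.intervalIntegrable _ _)
      (fun θ hθ ↦ one_sub_div_pi_pow_mul_sin_pow_pos n N hθ) Real.pi_pos
  obtain ⟨K, hK0, hK⟩ := exists_measure_agreeAngleSet n N hs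
  -- the joint law of the features and the hash vectors
  have hmf : AEMeasurable (fun ω ↦ (ft ω, fs ω)) P := hft.aemeasurable.prodMk hfs.aemeasurable
  have hmw : AEMeasurable (fun ω j ↦ w j ω) P :=
    aemeasurable_pi_lambda _ fun j ↦ (hw j).aemeasurable
  have hlaw := hfw_indep.map_prod_eq_prod_map_map hmf hmw
  rw [hf_indep.map_prod_eq_prod_map_map hft.aemeasurable hfs.aemeasurable,
    hw_indep.map_fun_eq_pi_map fun j ↦ (hw j).aemeasurable, hft.map_eq, hfs.map_eq] at hlaw
  simp only [(hw _).map_eq] at hlaw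
  have hP : ∀ B : Set ℝ, MeasurableSet B →
      P ((fun ω ↦ ((ft ω, fs ω), fun j ↦ w j ω)) ⁻¹' agreeAngleSet (n + 2) N B) =
        K * ∫⁻ φ in B ∩ Set.Ioo 0 Real.pi, ENNReal.ofReal (f φ) := fun B hB ↦ by
    rw [← hK B hB, ← hlaw, Measure.map_apply_of_aemeasurable (hmf.prodMk hmw)
      (measurableSet_agreeAngleSet _ _ hB)]
  set S : Set Ω := {ω | ∀ j, SignsAgree (inner ℝ (w j ω) (ft ω)) (inner ℝ (w j ω) (fs ω))} with hS
  have hSpre : S = (fun ω ↦ ((ft ω, fs ω), fun j ↦ w j ω)) ⁻¹'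
      agreeAngleSet (n + 2) N Set.univ := by
    ext ω; simp [hS, agreeAngleSet]
  have hSm : NullMeasurableSet S P := hSpre ▸ (hmf.prodMk hmw).nullMeasurable
    (measurableSet_agreeAngleSet _ _ .univ)
  have hPS : P S = K * ENNReal.ofReal (∫ θ in (0 : ℝ)..Real.pi, f θ) := by
    rw [hSpre, hP _ .univ, Set.univ_inter,
      lintegral_Ioo_eq_ofReal_intervalIntegral n N Real.pi_pos.le le_rfl]
  have hPT : P ({ω | InnerProductGeometry.angle (ft ω) (fs ω) < ε} ∩ S) =
      K * ENNReal.ofReal (∫ θ in (0 : ℝ)..ε, f θ) := by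
    have hBε : Set.Iio ε ∩ Set.Ioo 0 Real.pi = Set.Ioo 0 ε := by
      ext θ
      simp only [Set.mem_inter_iff, Set.mem_Iio, Set.mem_Ioo]
      exact ⟨fun h ↦ ⟨h.2.1, h.1⟩, fun h ↦ ⟨h.2, h.1, h.2.trans hεπ⟩⟩
    rw [← lintegral_Ioo_eq_ofReal_intervalIntegral n N hε₀.le hεπ.le, ← hBε,
      ← hP _ measurableSet_Iio, Set.inter_comm]
    rfl
  have hPS0 : 0 < P S := by
    rw [hPS]
    exact ENNReal.mul_pos hK0 (ENNReal.ofReal_pos.2 hIpos).ne'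
  refine ⟨hPS0, hIpos, ?_⟩
  -- the constant is finite since `P S` is, and cancels in the quotient
  have hKtop : K ≠ ⊤ := fun h ↦ by
    rw [h, ENNReal.top_mul (ENNReal.ofReal_pos.2 hIpos).ne'] at hPS
    exact measure_ne_top P S hPS
  have hIε : 0 ≤ ∫ θ in (0 : ℝ)..ε, f θ :=
    (intervalIntegral.intervalIntegral_pos_of_pos_on (hfc.intervalIntegrable _ _)
      (fun θ hθ ↦ one_sub_div_pi_pow_mul_sin_pow_pos n N ⟨hθ.1, hθ.2.trans hεπ⟩) hε₀).le
  rw [measureReal_def, ProbabilityTheory.cond, Measure.smul_apply, Measure.restrict_apply₀' hSm,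
    hPT, hPS, smul_eq_mul, ENNReal.toReal_mul, ENNReal.toReal_inv, ENNReal.toReal_mul,
    ENNReal.toReal_mul, ENNReal.toReal_ofReal hIpos.le, ENNReal.toReal_ofReal hIε]
  have hK' : K.toReal ≠ 0 := (ENNReal.toReal_pos hK0 hKtop).ne'
  have := hIpos.ne'
  field_simp
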